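/- **Setting.** Fix $n$ parameters $X_1,\dots,X_n$ with companions $\overline{X_1},\dots,\overline{X_n}$, and let $\mathbb X$ be the set of these $2n$ symbols. Monomials over $\mathbb X$ are finite multisets $\mu:\mathbb X\to\mathbb N$. *Language* $\mathrm{PCF}\langle\vec X\rangle$. Terms (up to $\alpha$-equivalence): $M::=\mathsf 0\mid\mathsf{succ}\,M\mid\mathsf{pred}\,M\mid\mathsf{ifz}(M,M,M)\mid x\mid\lambda x.M\mid MM\mid \mathrm YM\mid M\oplus_{X_i}M$, with $\mathsf k:=\mathsf{succ}^k\mathsf 0$. Types: $A::=\mathrm{Bool}\mid\mathbf N\mid A\to A$. Typing is Curry style, with the usual rules for variables, abstraction and application, and: $\Gamma\vdash\mathsf 0:\mathbf N$; $\Gamma\vdash\mathsf 0,\mathsf 1:\mathrm{Bool}$; the cast from $\Gamma\vdash M:\mathrm{Bool}$ to $\Gamma\vdash M:\mathbf N$; $\mathsf{succ},\mathsf{pred}$ from $\mathbf N$ to $\mathbf N$; $\mathsf{ifz}(M,N,P):A$ from $M:\mathbf N$ and $N,P:A$; $M\oplus_{X_i}N:A$ from $M,N:A$; $\mathrm YM:A$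 from $M:A\to A$. *Semantics.* $\llbracket\mathrm{Bool}\rrbracket=\{0,1\}$, $\llbracket\mathbf N\rrbracket=\mathbb N$, $\llbracket A\to B\rrbracket=\,!\llbracket A\rrbracket\times\llbracket B\rrbracket$, where $!S$ is the set of finite multisets over $S$; a pair $(m,b)\in\llbracket A\to B\rrbracket$ is also written $m\multimap b$. A derivation $\Pi$ of $\Gamma\vdash M:A$ is interpreted by a family $(\llbracket M\rrbracket_a)_{a\in\llbracket A\rrbracket}$ of formal power series over $\mathbb N^\infty[[\mathbb X]]$ in commuting variables $x_a$ ($x$ declared in $\Gamma$, $a\in\llbracket\Gamma(x)\rrbracket$); $\llbracket M\rrbracket_{\gamma,a}\in\mathbb N^\infty[[\mathbb X]]$ is the coefficient at the monomial $\prod_x x^{\gamma(x)}$. It is defined by: $\llbracket x\rrbracket_a=x_a$; $\llbracket\mathsf k\rrbracket_k=1$ and $\llbracket\mathsf k\rrbracket_j=0$ for $j\ne k$ when $\mathsf k$ is introduced by an axiom; cast is extension by $0$; $\llbracket\mathsf{succ}\,M\rrbracket_{k+1}=\llbracket M\rrbracket_k$ and $\llbracket\mathsf{succ}\,M\rrbracket_0=0$;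 $\llbracket\mathsf{pred}\,M\rrbracket_k=\sum_{j\dotdiv 1=k}\llbracket M\rrbracket_j$, where $j\dotdiv 1=\max(j-1,0)$; $\llbracket\lambda x.M\rrbracket_{\gamma,\,m\multimap b}=\llbracket M\rrbracket_{(\gamma,x:m),\,b}$; for $N:B$, $\llbracket MN\rrbracket_a=\sum_{m\in!\llbracket B\rrbracket}\llbracket M\rrbracket_{m\multimap a}\prod_{b\in m}\llbracket N\rrbracket_b$; $\llbracket\mathsf{ifz}(M,N,P)\rrbracket_a=\llbracket M\rrbracket_0\llbracket N\rrbracket_a+\sum_k\llbracket M\rrbracket_{k+1}\llbracket P\rrbracket_a$; $\llbracket M\oplus_{X_i}N\rrbracket_a=X_i\llbracket M\rrbracket_a+\overline{X_i}\llbracket N\rrbracket_a$; $\llbracket \mathrm YM\rrbracket=\sup_k f_k$ with $f_0=0$ and $f_{k+1,a}=\sum_m\llbracket M\rrbracket_{m\multimap a}\prod_{b\in m}f_{k,b}$. For a power series $f$, $\mathrm{supp}(f)$ is the set of monomials with non-zero coefficient. *Tropical notions.* $\mathbb T$ is $[0,\infty]$ with $\min$ as sum and $+$ as product. For a power series $s$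 over $\mathbb T$ and $q\in\mathbb T^{\mathbb X}$, $s^!(q)=\inf_\mu(s_\mu+\mu\cdot q)$. For $f\in\mathbb N^\infty[[\mathbb X]]$, $\mathsf t^!f(q)=\inf_{\mu\in\mathrm{supp}(f)}\mu\cdot q$. For a polynomial $s\in\mathbb T[\mathbb X]$, $s_{\min}$ is the sum, with coefficients one, of those vertices of the convex hull of $\mathrm{supp}(s)$ that are minimal among the vertices for the pointwise order. *The system* $\mathbf P_{\mathrm{trop}}$. Types: $a::=k\in\mathbb N\mid[a,\dots,a]\multimap a$, where $[\dots]$ is a finite multiset; the elements of $\llbracket A\rrbracket$ are regarded as such types. A context $\gamma$ maps variables to finite multisets of types, all but finitely many of them empty; contexts are added pointwise. A judgement $M:\langle\gamma_j\vdash^{s_j}a_j\rangle_{j\in J}$ is a finite family of typings with pairwise distinct $(\gamma_j,a_j)$ and polynomials $s_j\in\mathbb T[\mathbb X]$ such that $s_j=(s_j)_{\min}$. The operation $\mathrm{merge}$ adds up the polynomials of typings with equal context and type, and then minimizes each of them. A family that occurs as a premise may list the same typing several times. Rules: - $M:\emptyset$ for every $M$; $x:\langle x:[a_i]\vdash^1a_i\rangle_{i}$;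 $\mathsf k:\langle\vdash^1k\rangle$. - From $M:\langle\gamma_i\vdash^{s_i}k_i\rangle_i$ with $k_i\in\mathbb N$: $\mathsf{succ}\,M:\langle\gamma_i\vdash^{s_i}k_i+1\rangle_i$ and $\mathsf{pred}\,M:\mathrm{merge}\langle\gamma_i\vdash^{s_i}k_i\dotdiv1\rangle_i$. - From $M:\langle\gamma_i\vdash^{s_i}k_i\rangle_i$ with $k_i\in\mathbb N$, $N:\langle\delta_j\vdash^{t_j}a_j\rangle_j$ and $P:\langle\delta'_l\vdash^{t'_l}a'_l\rangle_l$: $\mathsf{ifz}(M,N,P):\mathrm{merge}$ of all $\gamma_i+\delta_j\vdash^{(s_it_j)_{\min}}a_j$ with $k_i=0$ and all $\gamma_i+\delta'_l\vdash^{(s_it'_l)_{\min}}a'_l$ with $k_i>0$. - From $M:\langle\gamma_i\vdash^{s_i}a_i\rangle_i$ and $N:\langle\delta_j\vdash^{t_j}b_j\rangle_j$: $M\oplus_{X}N:\mathrm{merge}\langle\gamma_i\vdash^{s_iX}a_i\mid\delta_j\vdash^{t_j\overline X}b_j\rangle_{i,j}$. - From $M:\langle\gamma_i,x:m_i\vdash^{s_i}b_i\rangle_i$: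 $\lambda x.M:\langle\gamma_i\vdash^{s_i}m_i\multimap b_i\rangle_i$. - From $M:\langle\gamma_i\vdash^{s_i}[m_{i1},\dots,m_{ip_i}]\multimap b_i\rangle_i$ and $N:\langle\delta_{ij}\vdash^{s'_{ij}}m_{ij}\rangle_{i,j}$: $MN:\mathrm{merge}\langle\gamma_i+\sum_j\delta_{ij}\vdash^{(s_i\prod_js'_{ij})_{\min}}b_i\rangle_i$. The rule $(\mathrm Y)$ is the same with $\mathrm YM$ in place of both $N$ and $MN$. *Refinement.* $(\gamma,a)$ refines $(\Gamma,A)$ if $a\in\llbracket A\rrbracket$, $\gamma(x)\in\,!\llbracket\Gamma(x)\rrbracket$ for every $x$ declared in $\Gamma$, and $\gamma(x)=[\,]$ otherwise. A $\mathbf P_{\mathrm{trop}}$-derivation $\pi$ for $M$ refines a derivation $\Pi$ of $\Gamma\vdash M:A$, inductively, if all typings in its conclusion refine $(\Gamma,A)$ and one of the following holds: $\pi$ is $M:\emptyset$, by the axiom; $\pi$ and $\Pi$ are corresponding axioms; $\pi$ and $\Pi$ end with corresponding rules, other than $\mathrm Y$, and the immediate subderivations of $\pi$ refine those of $\Pi$;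 $\Pi$ ends with a cast and $\pi$ refines its premise; or $\Pi$ ends with the rule $\mathrm Y$ applied to $\Pi'$, $\pi$ ends with a cluster of $h$ consecutive $\mathrm Y$-rules, and the derivation for $M^{(h)}y$ ($M^{(0)}y=y$, $M^{(h+1)}y=M(M^{(h)}y)$, $y$ fresh) obtained from $\pi$ by replacing these $h$ rules by application rules refines the derivation of $\Gamma,y:A\vdash M^{(h)}y:A$ built from $h$ copies of (the weakening of) $\Pi'$. **Theorem (Soundness of $\mathbf P_{\mathrm{trop}}$).** (1) Let $\Pi$ be a $\mathrm{PCF}\langle\vec X\rangle$-derivation of $\Gamma\vdash M:A$, and let $(\gamma,a)$ refine $(\Gamma,A)$. For every $\mathbf P_{\mathrm{trop}}$-derivation $\pi$ of $M:\langle\gamma\vdash^sa\rangle$ that refines $\Pi$, $\mathrm{supp}(s)\subseteq\mathrm{supp}(\llbracket M\rrbracket_{\gamma,a})$. (2) Let $\Pi$ be a $\mathrm{PCF}\langle\vec X\rangle$-derivation of $\vdash M:\mathbf N$ and let $k\in\mathbb N$. For every $\mathbf P_{\mathrm{trop}}$-derivation $\pi$ of $M:\langle\vdash^sk\rangle$ that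 refines $\Pi$, $\mathsf t^!\llbracket M\rrbracket_k(q)\le s^!(q)$ for all $q\in\mathbb T^{\mathbb X}$, where $\le$ is the usual order of $[0,\infty]$. -/

import Mathlib

namespace PCFX

noncomputable section

open Classical

/-! ### The language: types, terms, typing derivations -/

/-- Simple types. -/
inductive Ty : Type
  | bool : Ty
  | nat : Ty
  | arr : Ty → Ty → Ty

/-- Terms with `n` choice parameters, up to alpha-equivalence (de Bruijn indices).
`choice i M N` is the parametric choice between `M` and `N` with parameter `X_i`. -/
inductive Term (n : ℕ) : Type
  | zero : Term n
  | succ : Term n → Term n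
  | pred : Term n → Term n
  | ifz : Term n → Term n → Term n → Term n
  | var : ℕ → Term n
  | lam : Term n → Term n
  | app : Term n → Term n → Term n
  | fix : Term n → Term n
  | choice : Fin n → Term n → Term n → Term n

/-- The numeral `succ (... (succ zero))`. -/
def numeral {n : ℕ} : ℕ → Term n
  | 0 => .zero
  | k + 1 => .succ (numeral k)

/-- Typing derivations `Γ ⊢ M : A` (Curry style); variable `i` has the type `Γ[i]`. -/
inductive Deriv {n : ℕ} : List Ty → Term n → Ty → Type
  | zeroNat {Γ : List Ty} : Deriv Γ .zero .nat
  | zeroBool {Γ : List Ty} : Deriv Γ .zero .bool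
  | oneBool {Γ : List Ty} : Deriv Γ (.succ .zero) .bool
  | cast {Γ : List Ty} {M : Term n} : Deriv Γ M .bool → Deriv Γ M .nat
  | succ {Γ : List Ty} {M : Term n} : Deriv Γ M .nat → Deriv Γ (.succ M) .nat
  | pred {Γ : List Ty} {M : Term n} : Deriv Γ M .nat → Deriv Γ (.pred M) .nat
  | var {Γ : List Ty} {A : Ty} (i : ℕ) (h : Γ[i]? = some A) : Deriv Γ (.var i) A
  | lam {Γ : List Ty} {A B : Ty} {M : Term n} :
      Deriv (A :: Γ) M B → Deriv Γ (.lam M) (.arr A B)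
  | app {Γ : List Ty} {A B : Ty} {M N : Term n} :
      Deriv Γ M (.arr B A) → Deriv Γ N B → Deriv Γ (.app M N) A
  | ifz {Γ : List Ty} {A : Ty} {M N P : Term n} :
      Deriv Γ M .nat → Deriv Γ N A → Deriv Γ P A → Deriv Γ (.ifz M N P) A
  | choice {Γ : List Ty} {A : Ty} {M N : Term n} (i : Fin n) :
      Deriv Γ M A → Deriv Γ N A → Deriv Γ (.choice i M N) A
  | fix {Γ : List Ty} {A : Ty} {M : Term n} :
      Deriv Γ M (.arr A A) → Deriv Γ (.fix M) A

/-! ### Intersection types, contexts, webs -/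

/-- The functor `α ↦ ℕ + (multisets over α) × α`. -/
def PTypeF (α : Type) : Type := ℕ ⊕ (Multiset α × α)

/-- `PTypeF` is a quotient of the polynomial functor of finite lists: a natural number, or a list
`f 0, …, f (k - 1)` of elements followed by one more element. -/
instance : QPF PTypeF where
  map f x := Sum.map id (Prod.map (Multiset.map f) f) x
  P := ⟨ℕ ⊕ ℕ, fun s => Sum.elim (fun _ => Empty) (fun k => Option (Fin k)) s⟩
  abs := fun {α} x => match x with
    | ⟨.inl k, _⟩ => (Sum.inl k : ℕ ⊕ (Multiset α × α))
    | ⟨.inr _, f⟩ => (Sum.inr (Finset.univ.val.map fun i => f (some i), f none) :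
        ℕ ⊕ (Multiset α × α))
  repr := fun {α} x => match (x : ℕ ⊕ (Multiset α × α)) with
    | .inl k => ⟨.inl k, fun e => e.elim⟩
    | .inr (m, a) => ⟨.inr m.toList.length, fun o => o.elim a fun i => m.toList.get i⟩
  abs_repr := by
    rintro α (k | ⟨m, a⟩)
    · rfl
    · show (Sum.inr _ : ℕ ⊕ (Multiset α × α)) = Sum.inr _
      congr 2
      have h : (Finset.univ.val.map fun i => m.toList.get i) = (m.toList : Multiset α) := by
        rw [Fin.univ_val_map, List.ofFn_get]
      exact h.trans (Multiset.coe_toList m)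
  abs_map := by
    rintro α β f ⟨k | k, g⟩
    · rfl
    · show (Sum.inr _ : ℕ ⊕ (Multiset β × β)) = Sum.inr _
      congr 2
      exact (Multiset.map_map _ _ _).symm

/-- The types `a ::= k ∈ ℕ | [a, …, a] ⊸ a`, with `[a, …, a]` a finite multiset: the initial
algebra of `PTypeF`. -/
def PType : Type := QPF.Fix PTypeF

namespace PType

/-- The type `k`. -/
def base (k : ℕ) : PType := QPF.Fix.mk (Sum.inl k : ℕ ⊕ (Multiset PType × PType))

/-- The type `m ⊸ a`. -/
def arrow (m : Multiset PType) (a : PType) : PType :=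
  QPF.Fix.mk (Sum.inr (m, a) : ℕ ⊕ (Multiset PType × PType))

/-- Case analysis: `base k` gives `inl k` and `arrow m a` gives `inr (m, a)`. -/
def dest (t : PType) : ℕ ⊕ (Multiset PType × PType) := QPF.Fix.dest t

theorem dest_base (k : ℕ) : (base k).dest = Sum.inl k := QPF.Fix.dest_mk (F := PTypeF) _

theorem dest_arrow (m : Multiset PType) (a : PType) : (arrow m a).dest = Sum.inr (m, a) :=
  QPF.Fix.dest_mk (F := PTypeF) _

end PType

/-- A context: a map from variables to finite multisets of types, all but finitely many of them
empty. It is given by its multiplicities: `γ (x, a)` is the multiplicity of `a` in `γ(x)`.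
It is also read as a monomial in the variables `(x, a)`. -/
abbrev Ctx : Type := ℕ × PType →₀ ℕ

/-- The context `γ` with all variables shifted by one and with `m` for the new variable `0`. -/
def Ctx.cons (m : Multiset PType) (γ : Ctx) : Ctx :=
  (Multiset.toFinsupp m).mapDomain (fun a => (0, a)) +
    γ.mapDomain (fun p => (p.1 + 1, p.2))

/-- The set `⟦A⟧` that interprets a simple type: `⟦bool⟧ = {0, 1}`, `⟦nat⟧ = ℕ`, and `⟦A → B⟧` is
the set of all `m ⊸ b` with `m` a finite multiset over `⟦A⟧` and `b ∈ ⟦B⟧`. -/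
def web : Ty → Set PType
  | .bool => {PType.base 0, PType.base 1}
  | .nat => Set.range PType.base
  | .arr A B => {t | ∃ m b, t = PType.arrow m b ∧ (∀ a ∈ m, a ∈ web A) ∧ b ∈ web B}

/-- `(γ, a)` refines `(Γ, A)`: `a ∈ ⟦A⟧`, `γ(x)` is a multiset over `⟦Γ(x)⟧` for every declared `x`,
and `γ(x) = []` for every other `x`. -/
def Adequate (Γ : List Ty) (A : Ty) (γ : Ctx) (a : PType) : Prop :=
  a ∈ web A ∧ ∀ p ∈ γ.support, ∃ B, Γ[p.1]? = some B ∧ p.2 ∈ web B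

/-! ### Parametric weighted relational semantics -/

/-- The formal parameters: `inl i` is `X_i` and `inr i` is its companion `X̄_i`. -/
abbrev Param (n : ℕ) : Type := Fin n ⊕ Fin n

/-- Formal power series over `ℕ∞` in the parameters. -/
abbrev FPS (n : ℕ) : Type := MvPowerSeries (Param n) ℕ∞

/-- Formal power series over `FPS n` in the variables `(x, a)`. -/
abbrev Ser (n : ℕ) : Type := MvPowerSeries (ℕ × PType) (FPS n)

/-- Supremum of a family of series, coefficientwise. -/
def Ser.sup {n : ℕ} {ι : Type} (f : ι → Ser n) : Ser n :=
  fun γ μ => ⨆ i, MvPowerSeries.coeff μ (MvPowerSeries.coeff γ (f i))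

/-- Sum of an arbitrary family of series: the supremum of its finite partial sums. -/
def Ser.sum {n : ℕ} {ι : Type} (f : ι → Ser n) : Ser n :=
  Ser.sup fun s : Finset ι => ∑ i ∈ s, f i

/-- Interpretation of an application with argument of type `B`:
`⟦M N⟧_a = ∑_{m ∈ !⟦B⟧} ⟦M⟧_{m ⊸ a} · ∏_{b ∈ m} ⟦N⟧_b`. -/
def appSer {n : ℕ} (B : Ty) (f g : PType → Ser n) (a : PType) : Ser n :=
  Ser.sum fun m : {m : Multiset PType // ∀ b ∈ m, b ∈ web B} =>
    f (PType.arrow m.1 a) * (m.1.map g).prod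

/-- The interpretation of a typing derivation of `Γ ⊢ M : A` as a family of power series. The
coefficient `⟦M⟧_{γ,a} ∈ ℕ∞[[X_1, X̄_1, …, X_n, X̄_n]]` is `coeff γ (interp D a)`. -/
def interp {n : ℕ} {Γ : List Ty} {M : Term n} {A : Ty} (D : Deriv Γ M A) : PType → Ser n :=
  match D with
  | .zeroNat => fun a => if a = PType.base 0 then 1 else 0
  | .zeroBool => fun a => if a = PType.base 0 then 1 else 0
  | .oneBool => fun a => if a = PType.base 1 then 1 else 0
  | .cast D => fun a => if a ∈ web .bool then interp D a else 0
  | .succ D => fun a => match a.dest with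
      | .inl (k + 1) => interp D (PType.base k)
      | _ => 0
  | .pred D => fun a => match a.dest with
      | .inl 0 => interp D (PType.base 0) + interp D (PType.base 1)
      | .inl (k + 1) => interp D (PType.base (k + 2))
      | .inr _ => 0
  | .var (A := A) i _ => fun a => if a ∈ web A then MvPowerSeries.X (i, a) else 0
  | .lam D => fun a => match a.dest with
      | .inl _ => 0
      | .inr (m, b) => fun γ : Ctx => MvPowerSeries.coeff (Ctx.cons m γ) (interp D b)
  | .app (B := B) D E => appSer B (interp D) (interp E)
  | .ifz D E F => fun a =>
      interp D (PType.base 0) * interp E a +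
        Ser.sum fun k : ℕ => interp D (PType.base (k + 1)) * interp F a
  | .choice i D E => fun a =>
      MvPowerSeries.C (MvPowerSeries.X (Sum.inl i)) * interp D a +
        MvPowerSeries.C (MvPowerSeries.X (Sum.inr i)) * interp E a
  | .fix (A := A) D => fun a =>
      Ser.sup fun k : ℕ => (appSer A (interp D))^[k] (fun _ => 0) a

/-- The support of a formal power series. -/
def FPS.supp {n : ℕ} (f : FPS n) : Set (Param n →₀ ℕ) := {μ | MvPowerSeries.coeff μ f ≠ 0}

/-! ### Tropical polynomials and minimization -/

/-- The tropical semiring: `[0, ∞]` with `min` as sum and `+` as product. -/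
abbrev Trop : Type := Tropical ENNReal

/-- Formal polynomials over the tropical semiring in the parameters. -/
abbrev TPoly (n : ℕ) : Type := MvPolynomial (Param n) Trop

/-- A monomial as a point of `ℝ^{2n}`. -/
def point {n : ℕ} (μ : Param n →₀ ℕ) : Param n → ℝ := fun i => (μ i : ℝ)

/-- The Newton polytope: the convex hull of the support. -/
def newtonPolytope {n : ℕ} (s : TPoly n) : Set (Param n → ℝ) :=
  convexHull ℝ (point '' (s.support : Set (Param n →₀ ℕ)))

/-- The vertices of the Newton polytope, as monomials. -/
def vert {n : ℕ} (s : TPoly n) : Set (Param n →₀ ℕ) :=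
  {μ | point μ ∈ (newtonPolytope s).extremePoints ℝ}

/-- The minimal polynomial `s_min`: the sum, with coefficients one, of those vertices of the Newton
polytope that are minimal among the vertices for the pointwise order. -/
def minim {n : ℕ} (s : TPoly n) : TPoly n :=
  ∑ μ ∈ s.support.filter (fun μ => Minimal (fun ν => ν ∈ vert s) μ), MvPolynomial.monomial μ 1

/-- The value at `q` of the function `s^!` of a tropical power series `s`:
`s^!(q) = inf_μ (s_μ + μ · q)`, with the usual order of `[0, ∞]`. -/
def tropEval {n : ℕ} (s : MvPowerSeries (Param n) Trop) (q : Param n → ENNReal) : ENNReal :=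
  ⨅ μ : Param n →₀ ℕ, (Tropical.untrop (MvPowerSeries.coeff μ s) + ∑ i, (μ i : ENNReal) * q i)

/-- The tropical series `t(f)`: it has the coefficient one on the support of `f`, and the
coefficient zero elsewhere. -/
def tropicalize {n : ℕ} (f : FPS n) : MvPowerSeries (Param n) Trop :=
  fun μ => if μ ∈ f.supp then 1 else 0

/-! ### The type system -/

/-- A typing `γ ⊢^s a` (of a term that is left implicit). -/
structure Typing (n : ℕ) : Type where
  ctx : Ctx
  poly : TPoly n
  ty : PType

/-- A typing `γ ⊢^s k` with `k ∈ ℕ`. -/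
structure NatTyping (n : ℕ) : Type where
  ctx : Ctx
  poly : TPoly n
  val : ℕ

/-- A typing `γ, x : m ⊢^s b` with a distinguished variable `x`. -/
structure LamTyping (n : ℕ) : Type where
  ctx : Ctx
  arg : Multiset PType
  poly : TPoly n
  ty : PType

/-- A typing `γ ⊢^s m ⊸ b` of a function, together with a multiset of typings
`δ_j ⊢^{s_j} m_j` of its argument such that `m = [m_1, …, m_p]`. -/
structure AppTyping (n : ℕ) : Type where
  ctx : Ctx
  poly : TPoly n
  args : Multiset (Typing n)
  ty : PType

/-- `γ ⊢^s k` as a typing, with `k` replaced by `f k`. -/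
def NatTyping.toTyping {n : ℕ} (f : ℕ → ℕ) (e : NatTyping n) : Typing n :=
  ⟨e.ctx, e.poly, PType.base (f e.val)⟩

/-- The typing of the body. -/
def LamTyping.body {n : ℕ} (e : LamTyping n) : Typing n :=
  ⟨Ctx.cons e.arg e.ctx, e.poly, e.ty⟩

/-- The typing of the abstraction. -/
def LamTyping.abs {n : ℕ} (e : LamTyping n) : Typing n :=
  ⟨e.ctx, e.poly, PType.arrow e.arg e.ty⟩

/-- The typing `γ ⊢^s [m_1, …, m_p] ⊸ b` of the function. -/
def AppTyping.fn {n : ℕ} (e : AppTyping n) : Typing n :=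
  ⟨e.ctx, e.poly, PType.arrow (e.args.map Typing.ty) e.ty⟩

/-- The typing of the application: contexts are added, and the polynomial is the minimization of
the product of all the polynomials. -/
def AppTyping.result {n : ℕ} (e : AppTyping n) : Typing n :=
  ⟨e.ctx + (e.args.map Typing.ctx).sum, minim (e.poly * (e.args.map Typing.poly).prod), e.ty⟩

/-- `merge`: typings with the same context and the same type are merged by adding up their
polynomials, and every polynomial so obtained is minimized. -/
def merge {n : ℕ} (E : Multiset (Typing n)) : Finset (Typing n) :=
  (E.map fun e => (e.ctx, e.ty)).toFinset.image fun k =>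
    ⟨k.1, minim ((E.filter fun e => (e.ctx, e.ty) = k).map Typing.poly).sum, k.2⟩

/-- Multiplication of the polynomial of a typing by `p`. -/
def Typing.scale {n : ℕ} (p : TPoly n) (e : Typing n) : Typing n := ⟨e.ctx, e.poly * p, e.ty⟩

/-- The typing of a conditional, from a typing of the guard and a typing of a branch. -/
def Typing.branch {n : ℕ} (f : NatTyping n) (e : Typing n) : Typing n :=
  ⟨f.ctx + e.ctx, minim (f.poly * e.poly), e.ty⟩

/-- Derivations of judgements `M : ⟨γ_j ⊢^{s_j} a_j⟩_{j ∈ J}`. A judgement is given by the finite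
set of its typings; a premise is a family of typings, in which one typing may occur repeatedly.
All the rules preserve the two properties of a judgement: that the pairs `(γ_j, a_j)` are pairwise
distinct (for `pred`, by `merge`, which changes nothing if they are distinct already), and that the
polynomials `s_j` are minimal. -/
inductive PDer {n : ℕ} : Term n → Finset (Typing n) → Type
  | empty (M : Term n) : PDer M ∅
  | id (x : ℕ) (I : Finset PType) :
      PDer (.var x) (I.image fun a => ⟨Finsupp.single (x, a) 1, 1, a⟩)
  | num (k : ℕ) (M : Term n) (h : M = numeral k) : PDer M {⟨0, 1, PType.base k⟩}
  | succ {M : Term n} (F : Finset (NatTyping n)) :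
      PDer M (F.image (NatTyping.toTyping fun k => k)) →
      PDer (.succ M) (F.image (NatTyping.toTyping fun k => k + 1))
  | pred {M : Term n} (F : Finset (NatTyping n)) :
      PDer M (F.image (NatTyping.toTyping fun k => k)) →
      PDer (.pred M) (merge (F.val.map (NatTyping.toTyping fun k => k - 1)))
  | ifz {M N P : Term n} (F : Finset (NatTyping n)) (J K : Finset (Typing n)) :
      PDer M (F.image (NatTyping.toTyping fun k => k)) → PDer N J → PDer P K →
      PDer (.ifz M N P)
        (merge
          ((((F.filter fun f => f.val = 0) ×ˢ J).val.map fun p => Typing.branch p.1 p.2) +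
            (((F.filter fun f => f.val ≠ 0) ×ˢ K).val.map fun p => Typing.branch p.1 p.2)))
  | choice {M N : Term n} (i : Fin n) (J K : Finset (Typing n)) :
      PDer M J → PDer N K →
      PDer (.choice i M N)
        (merge
          (J.val.map (Typing.scale (MvPolynomial.X (Sum.inl i))) +
            K.val.map (Typing.scale (MvPolynomial.X (Sum.inr i)))))
  | lam {M : Term n} (F : Finset (LamTyping n)) :
      PDer M (F.image LamTyping.body) → PDer (.lam M) (F.image LamTyping.abs)
  | app {M N : Term n} (F : Finset (AppTyping n)) :
      PDer M (F.image AppTyping.fn) → PDer N (F.biUnion fun e => e.args.toFinset) →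
      PDer (.app M N) (merge (F.val.map AppTyping.result))
  | fix {M : Term n} (F : Finset (AppTyping n)) :
      PDer M (F.image AppTyping.fn) → PDer (.fix M) (F.biUnion fun e => e.args.toFinset) →
      PDer (.fix M) (merge (F.val.map AppTyping.result))

/-! ### Unfolding and refinement -/

/-- The term `M^{(h)} y = M (M (... (M y)))`, with `y` the variable `k`. -/
def unfoldTerm {n : ℕ} (M : Term n) (k : ℕ) : ℕ → Term n
  | 0 => .var k
  | h + 1 => .app M (unfoldTerm M k h)

/-- Weakening of a typing derivation by one declaration, put at the outer end of the context, so
that the other variables keep their indices. -/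
def Deriv.wkn {n : ℕ} {Γ : List Ty} {M : Term n} {A : Ty} (C : Ty) (D : Deriv Γ M A) :
    Deriv (Γ ++ [C]) M A :=
  match D with
  | .zeroNat => .zeroNat
  | .zeroBool => .zeroBool
  | .oneBool => .oneBool
  | .cast D => .cast (D.wkn C)
  | .succ D => .succ (D.wkn C)
  | .pred D => .pred (D.wkn C)
  | .var i h => .var i (by
      rw [List.getElem?_append_left (List.getElem?_eq_some_iff.mp h).1]; exact h)
  | .lam D => .lam (D.wkn C)
  | .app D E => .app (D.wkn C) (E.wkn C)
  | .ifz D E F => .ifz (D.wkn C) (E.wkn C) (F.wkn C)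
  | .choice i D E => .choice i (D.wkn C) (E.wkn C)
  | .fix D => .fix (D.wkn C)

/-- The derivation of `Γ, y : A ⊢ M^{(h)} y : A` obtained from a derivation of `Γ ⊢ M : A → A`,
where `y` is the variable `Γ.length`, which is not declared in `Γ`. -/
def Deriv.unfold {n : ℕ} {Γ : List Ty} {M : Term n} {A : Ty} (D : Deriv Γ M (.arr A A)) :
    (h : ℕ) → Deriv (Γ ++ [A]) (unfoldTerm M Γ.length h) A
  | 0 => .var Γ.length (by simp)
  | h + 1 => .app (D.wkn A) (D.unfold h)

theorem fix_ne_numeral {n : ℕ} (M : Term n) (k : ℕ) : Term.fix M ≠ numeral k := by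
  cases k <;> simp [numeral]

/-- The height of the cluster of consecutive `fix` rules in which a derivation ends. -/
def PDer.cl {n : ℕ} {T : Term n} {J : Finset (Typing n)} (d : PDer T J) : ℕ :=
  match d with
  | .fix _ _ e => e.cl + 1
  | _ => 0

/-- Auxiliary form of `PDer.unfold`, in which the term is `fix M` up to a given equation. -/
def PDer.unfoldAux {n : ℕ} {T : Term n} (M : Term n) (k : ℕ) {J : Finset (Typing n)}
    (d : PDer T J) (h : T = .fix M) : PDer (unfoldTerm M k d.cl) J :=
  match d with
  | .empty _ => .empty (.var k)
  | .num i _ e => (fix_ne_numeral M i (h.symm.trans e)).elim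
  | .fix F d e => .app F ((Term.fix.inj h) ▸ d) (e.unfoldAux M k h)

/-- The unfolding of a derivation for `fix M`: in the final cluster, `fix` rules are replaced by
`app` rules. It is a derivation of the same judgement for `M^{(h)} y`, where `h` is the height of
the cluster and `y` is the variable `k`. -/
def PDer.unfold {n : ℕ} {M : Term n} (k : ℕ) {J : Finset (Typing n)} (d : PDer (.fix M) J) :
    PDer (unfoldTerm M k d.cl) J :=
  d.unfoldAux M k rfl

/-- All typings of `J` refine `(Γ, A)`. -/
def AdequateJ {n : ℕ} (Γ : List Ty) (A : Ty) (J : Finset (Typing n)) : Prop :=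
  ∀ e ∈ J, Adequate Γ A e.ctx e.ty

/-- The derivation `d` refines the typing derivation `D`. Being adequate is part of every clause;
the rules of `d` match those of `D`, except that `cast` is skipped and that derivations for `fix M`
are compared through their unfoldings. -/
inductive Refines {n : ℕ} : {Γ : List Ty} → {M : Term n} → {A : Ty} → {J : Finset (Typing n)} →
    PDer M J → Deriv Γ M A → Prop
  | empty {Γ : List Ty} {M : Term n} {A : Ty} (D : Deriv Γ M A) : Refines (.empty M) D
  | zeroNat {Γ : List Ty} (h : Term.zero = numeral 0) :
      Refines (.num 0 .zero h) (.zeroNat (Γ := Γ))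
  | zeroBool {Γ : List Ty} (h : Term.zero = numeral 0) :
      Refines (.num 0 .zero h) (.zeroBool (Γ := Γ))
  | oneBool {Γ : List Ty} (h : Term.succ .zero = numeral 1) :
      Refines (.num 1 (.succ .zero) h) (.oneBool (Γ := Γ))
  | var {Γ : List Ty} {A : Ty} (x : ℕ) (h : Γ[x]? = some A) (I : Finset PType) :
      AdequateJ (n := n) Γ A (I.image fun a => ⟨Finsupp.single (x, a) 1, 1, a⟩) →
      Refines (.id x I) (.var x h)
  | cast {Γ : List Ty} {M : Term n} {J : Finset (Typing n)} {d : PDer M J}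
      {D : Deriv Γ M .bool} :
      AdequateJ Γ .nat J → Refines d D → Refines d (.cast D)
  | succ {Γ : List Ty} {M : Term n} {F : Finset (NatTyping n)}
      {d : PDer M (F.image (NatTyping.toTyping fun k => k))} {D : Deriv Γ M .nat} :
      AdequateJ Γ .nat (F.image (NatTyping.toTyping fun k => k + 1)) →
      Refines d D → Refines (.succ F d) (.succ D)
  | pred {Γ : List Ty} {M : Term n} {F : Finset (NatTyping n)}
      {d : PDer M (F.image (NatTyping.toTyping fun k => k))} {D : Deriv Γ M .nat} :
      AdequateJ Γ .nat (merge (F.val.map (NatTyping.toTyping fun k => k - 1))) →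
      Refines d D → Refines (.pred F d) (.pred D)
  | ifz {Γ : List Ty} {A : Ty} {M N P : Term n} {F : Finset (NatTyping n)}
      {J K : Finset (Typing n)} {d : PDer M (F.image (NatTyping.toTyping fun k => k))}
      {e : PDer N J} {f : PDer P K} {D : Deriv Γ M .nat} {E : Deriv Γ N A} {G : Deriv Γ P A} :
      AdequateJ Γ A
        (merge
          ((((F.filter fun f => f.val = 0) ×ˢ J).val.map fun p => Typing.branch p.1 p.2) +
            (((F.filter fun f => f.val ≠ 0) ×ˢ K).val.map fun p => Typing.branch p.1 p.2))) →
      Refines d D → Refines e E → Refines f G → Refines (.ifz F J K d e f) (.ifz D E G)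
  | choice {Γ : List Ty} {A : Ty} {M N : Term n} {i : Fin n} {J K : Finset (Typing n)}
      {d : PDer M J} {e : PDer N K} {D : Deriv Γ M A} {E : Deriv Γ N A} :
      AdequateJ Γ A
        (merge
          (J.val.map (Typing.scale (MvPolynomial.X (Sum.inl i))) +
            K.val.map (Typing.scale (MvPolynomial.X (Sum.inr i))))) →
      Refines d D → Refines e E → Refines (.choice i J K d e) (.choice i D E)
  | lam {Γ : List Ty} {A B : Ty} {M : Term n} {F : Finset (LamTyping n)}
      {d : PDer M (F.image LamTyping.body)} {D : Deriv (A :: Γ) M B} :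
      AdequateJ Γ (.arr A B) (F.image LamTyping.abs) →
      Refines d D → Refines (.lam F d) (.lam D)
  | app {Γ : List Ty} {A B : Ty} {M N : Term n} {F : Finset (AppTyping n)}
      {d : PDer M (F.image AppTyping.fn)} {e : PDer N (F.biUnion fun e => e.args.toFinset)}
      {D : Deriv Γ M (.arr B A)} {E : Deriv Γ N B} :
      AdequateJ Γ A (merge (F.val.map AppTyping.result)) →
      Refines d D → Refines e E → Refines (.app F d e) (.app D E)
  | fix {Γ : List Ty} {A : Ty} {M : Term n} {J : Finset (Typing n)} {d : PDer (.fix M) J}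
      {D : Deriv Γ M (.arr A A)} :
      AdequateJ Γ A J → Refines (d.unfold Γ.length) (D.unfold d.cl) → Refines d (.fix D)

end

end PCFX

namespace PCFX

noncomputable section

open Classical

variable {n : ℕ}

/-! Sums in `ℕ∞` never cancel, and `ℕ∞` has no zero divisors. Whether a monomial occurs in a series
therefore commutes with sums, products and suprema: a monomial of a product is a sum of monomials of
the factors, and one of a supremum occurs in some member. On the tropical side only inclusions are
needed: minimization shrinks the support, and supports of sums and products lie in unions and
sumsets of supports. Hence each rule of the type system is dominated by the matching semantic
clause, and soundness follows by induction on refinement (`Refines.sound`), for all typings of a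
family at once because premises carry several typings.

The fixed point is the one case with extra content. A cluster of `h` fixed-point rules is compared
with `M^{(h)} y`, whose interpretation is the `h`-th iterate of the fixed-point operator started at
the variable `y` instead of `0`. The context of the typing does not mention `y`, and a monomial free
of `y` cannot use the starting value, so it already occurs in the iterate from `0`, hence in the
supremum (`occurs_fix_of_occurs_unfold`).

The tropical inequality follows from inclusion of supports, since the nonzero coefficients of the
tropicalization are the tropical one, that is, the real number `0`. -/

/-! ### Monomials that occur in a series -/

/-- The coefficient of `f` at the monomials `γ` (in the variables) and `μ` (in the parameters) is
non-zero. -/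
def Ser.Occurs (f : Ser n) (γ : Ctx) (μ : Param n →₀ ℕ) : Prop :=
  MvPowerSeries.coeff μ (MvPowerSeries.coeff γ f) ≠ 0

theorem Ser.occurs_add {f g : Ser n} {γ : Ctx} {μ : Param n →₀ ℕ} :
    (f + g).Occurs γ μ ↔ f.Occurs γ μ ∨ g.Occurs γ μ := by
  simp only [Ser.Occurs, map_add, ne_eq, add_eq_zero]
  tauto

theorem Ser.not_occurs_zero {γ : Ctx} {μ : Param n →₀ ℕ} : ¬ (0 : Ser n).Occurs γ μ := by
  simp [Ser.Occurs]

theorem Ser.occurs_one : (1 : Ser n).Occurs 0 0 := by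
  simp [Ser.Occurs]

/-- A Cauchy coefficient is a finite sum without cancellation, so it is non-zero as soon as one
summand is; a summand is non-zero exactly when both factors are. -/
theorem Ser.occurs_mul {f g : Ser n} {γ : Ctx} {μ : Param n →₀ ℕ} :
    (f * g).Occurs γ μ ↔ ∃ γ₁ γ₂ μ₁ μ₂, γ₁ + γ₂ = γ ∧ μ₁ + μ₂ = μ ∧
      f.Occurs γ₁ μ₁ ∧ g.Occurs γ₂ μ₂ := by
  simp only [Ser.Occurs, MvPowerSeries.coeff_mul, map_sum, ne_eq, Finset.sum_eq_zero_iff,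
    mul_eq_zero, Prod.forall]
  push Not
  constructor
  · rintro ⟨γ₁, γ₂, h, μ₁, μ₂, h', h₁, h₂⟩
    exact ⟨γ₁, γ₂, μ₁, μ₂, Finset.HasAntidiagonal.mem_antidiagonal.1 h, Finset.HasAntidiagonal.mem_antidiagonal.1 h', h₁, h₂⟩
  · rintro ⟨γ₁, γ₂, μ₁, μ₂, h, h', h₁, h₂⟩
    exact ⟨γ₁, γ₂, Finset.HasAntidiagonal.mem_antidiagonal.2 h, μ₁, μ₂, Finset.HasAntidiagonal.mem_antidiagonal.2 h', h₁, h₂⟩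

theorem Ser.Occurs.mul {f g : Ser n} {γ δ : Ctx} {μ ν : Param n →₀ ℕ}
    (hf : f.Occurs γ μ) (hg : g.Occurs δ ν) : (f * g).Occurs (γ + δ) (μ + ν) :=
  Ser.occurs_mul.2 ⟨γ, δ, μ, ν, rfl, rfl, hf, hg⟩

theorem Ser.occurs_C_X (p : Param n) :
    Ser.Occurs (MvPowerSeries.C (MvPowerSeries.X p)) 0 (Finsupp.single p 1) := by
  simp [Ser.Occurs, MvPowerSeries.coeff_X]

theorem Ser.occurs_X_iff {p : ℕ × PType} {γ : Ctx} {μ : Param n →₀ ℕ} :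
    Ser.Occurs (n := n) (MvPowerSeries.X p) γ μ ↔ γ = Finsupp.single p 1 ∧ μ = 0 := by
  rw [Ser.Occurs, MvPowerSeries.coeff_X]
  split_ifs with h <;> simp [h, MvPowerSeries.coeff_one]

theorem Ser.occurs_sup {ι : Type} {f : ι → Ser n} {γ : Ctx} {μ : Param n →₀ ℕ} :
    (Ser.sup f).Occurs γ μ ↔ ∃ i, (f i).Occurs γ μ := by
  change (⨆ i, MvPowerSeries.coeff μ (MvPowerSeries.coeff γ (f i))) ≠ 0 ↔ _
  rw [← bot_eq_zero, ne_eq, iSup_eq_bot]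
  simp [Ser.Occurs]

theorem Ser.occurs_finset_sum {ι : Type} {s : Finset ι} {f : ι → Ser n} {γ : Ctx}
    {μ : Param n →₀ ℕ} : (∑ i ∈ s, f i).Occurs γ μ ↔ ∃ i ∈ s, (f i).Occurs γ μ := by
  simp [Ser.Occurs, map_sum, Finset.sum_eq_zero_iff]

theorem Ser.occurs_sum {ι : Type} {f : ι → Ser n} {γ : Ctx} {μ : Param n →₀ ℕ} :
    (Ser.sum f).Occurs γ μ ↔ ∃ i, (f i).Occurs γ μ := by
  simp only [Ser.sum, Ser.occurs_sup, Ser.occurs_finset_sum]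
  constructor
  · rintro ⟨_, i, _, h⟩
    exact ⟨i, h⟩
  · rintro ⟨i, h⟩
    -- The one-term partial sum already witnesses the occurrence.
    exact ⟨{i}, i, Finset.mem_singleton_self i, h⟩

theorem occurs_appSer {B : Ty} {f g : PType → Ser n} {a : PType} {γ : Ctx}
    {μ : Param n →₀ ℕ} : (appSer B f g a).Occurs γ μ ↔ ∃ m : Multiset PType,
      (∀ b ∈ m, b ∈ web B) ∧ (f (PType.arrow m a) * (m.map g).prod).Occurs γ μ := by
  simp [appSer, Ser.occurs_sum]

/-! ### Weakening and unfolding -/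

/-- The new declaration sits at the outer end, so no index changes, and `interp` sees a context only
through the index and type of each variable used. -/
theorem interp_wkn {Γ : List Ty} {M : Term n} {A : Ty} (C : Ty) (D : Deriv Γ M A) :
    interp (D.wkn C) = interp D := by
  induction D <;> simp_all [Deriv.wkn, interp]

theorem interp_unfold {Γ : List Ty} {M : Term n} {A : Ty} (D : Deriv Γ M (.arr A A)) (h : ℕ) :
    interp (D.unfold h) = (appSer A (interp D))^[h]
      (fun a => if a ∈ web A then MvPowerSeries.X (Γ.length, a) else 0) := by
  induction h with
  | zero => simp [Deriv.unfold, interp]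
  | succ h ih =>
    rw [Function.iterate_succ_apply', ← ih]
    simp [Deriv.unfold, interp, interp_wkn]

/-- The variable `k` does not occur in `γ`. -/
def Ctx.Fresh (k : ℕ) (γ : Ctx) : Prop := ∀ a, γ (k, a) = 0

theorem Ctx.fresh_add {k : ℕ} {γ δ : Ctx} :
    Ctx.Fresh k (γ + δ) ↔ Ctx.Fresh k γ ∧ Ctx.Fresh k δ := by
  simp [Ctx.Fresh, forall_and]

/-- The index `Γ.length` is the first undeclared one; it is the variable `y` of the unfolding. -/
theorem Adequate.fresh {Γ : List Ty} {A : Ty} {γ : Ctx} {a : PType} (h : Adequate Γ A γ a) :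
    Ctx.Fresh Γ.length γ := by
  intro b
  by_contra hb
  obtain ⟨B, hB, _⟩ := h.2 (Γ.length, b) (Finsupp.mem_support_iff.2 hb)
  simp at hB

/-- A sum of contexts avoids `k` only if every summand does, so a comparison restricted to such
contexts passes through products. -/
theorem occurs_multiset_prod_of_fresh {k : ℕ} {g g' : PType → Ser n}
    (hg : ∀ b γ μ, Ctx.Fresh k γ → (g b).Occurs γ μ → (g' b).Occurs γ μ)
    (m : Multiset PType) : ∀ {γ : Ctx} {μ : Param n →₀ ℕ}, Ctx.Fresh k γ →
      (m.map g).prod.Occurs γ μ → (m.map g').prod.Occurs γ μ := by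
  induction m using Multiset.induction_on with
  | empty => simp
  | cons b m ih =>
    intro γ μ hγ h
    rw [Multiset.map_cons, Multiset.prod_cons] at h ⊢
    obtain ⟨γ₁, γ₂, μ₁, μ₂, rfl, rfl, h₁, h₂⟩ := Ser.occurs_mul.1 h
    rw [Ctx.fresh_add] at hγ
    exact (hg _ _ _ hγ.1 h₁).mul (ih hγ.2 h₂)

/-- The operator `appSer A f` is monotone for the comparison restricted to contexts avoiding `k`,
whatever `f` is. -/
theorem occurs_iterate_appSer_of_fresh {k : ℕ} {A : Ty} (f : PType → Ser n)
    {g g' : PType → Ser n}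
    (hg : ∀ b γ μ, Ctx.Fresh k γ → (g b).Occurs γ μ → (g' b).Occurs γ μ) (h : ℕ) :
    ∀ b γ μ, Ctx.Fresh k γ → ((appSer A f)^[h] g b).Occurs γ μ →
      ((appSer A f)^[h] g' b).Occurs γ μ := by
  induction h with
  | zero => exact hg
  | succ h ih =>
    intro b γ μ hγ H
    rw [Function.iterate_succ_apply'] at H ⊢
    obtain ⟨m, hm, H⟩ := occurs_appSer.1 H
    obtain ⟨γ₁, γ₂, μ₁, μ₂, rfl, rfl, h₁, h₂⟩ := Ser.occurs_mul.1 H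
    exact occurs_appSer.2 ⟨m, hm, h₁.mul
      (occurs_multiset_prod_of_fresh ih m (Ctx.fresh_add.1 hγ).2 h₂)⟩

theorem occurs_fix_of_occurs_unfold {Γ : List Ty} {M : Term n} {A : Ty}
    (D : Deriv Γ M (.arr A A)) (h : ℕ) {a : PType} {γ : Ctx} {μ : Param n →₀ ℕ}
    (hγ : Ctx.Fresh Γ.length γ) (H : (interp (D.unfold h) a).Occurs γ μ) :
    (interp (.fix D) a).Occurs γ μ := by
  rw [interp_unfold] at H
  rw [interp]
  refine Ser.occurs_sup.2 ⟨h, occurs_iterate_appSer_of_fresh (interp D) ?_ h a γ μ hγ H⟩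
  intro b γ μ hγ H
  split_ifs at H with hb
  -- The only monomial of the starting value is a variable `(y, b)`, which a context avoiding `y`
  -- excludes.
  · rw [(Ser.occurs_X_iff.1 H).1] at hγ
    simpa using hγ b
  · exact (Ser.not_occurs_zero H).elim

/-! ### Typings that are sound for a family of series -/

/-- Every monomial of the polynomial of the typing occurs in the corresponding coefficient. -/
def Typing.Sound (f : PType → Ser n) (e : Typing n) : Prop :=
  ∀ μ ∈ e.poly.support, (f e.ty).Occurs e.ctx μ

/-- The only property of minimization that soundness needs; convexity plays no role. -/
theorem support_minim_subset (s : TPoly n) : (minim s).support ⊆ s.support := by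
  intro μ hμ
  obtain ⟨ν, hν, h⟩ := Finset.mem_biUnion.1 (MvPolynomial.support_sum hμ)
  rw [Finset.mem_singleton.1 (MvPolynomial.support_monomial_subset h)]
  exact (Finset.mem_filter.1 hν).1

theorem exists_mem_support_of_multiset_sum {μ : Param n →₀ ℕ} (S : Multiset (TPoly n))
    (h : μ ∈ S.sum.support) : ∃ s ∈ S, μ ∈ s.support := by
  induction S using Multiset.induction_on with
  | empty => simp at h
  | cons s S ih =>
    rw [Multiset.sum_cons] at h
    rcases Finset.mem_union.1 (MvPolynomial.support_add h) with h | h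
    · exact ⟨s, Multiset.mem_cons_self s S, h⟩
    · obtain ⟨t, ht, h⟩ := ih h
      exact ⟨t, Multiset.mem_cons_of_mem ht, h⟩

theorem exists_add_of_mem_support_mul {s t : TPoly n} {μ : Param n →₀ ℕ}
    (h : μ ∈ (s * t).support) : ∃ μ₁ ∈ s.support, ∃ μ₂ ∈ t.support, μ₁ + μ₂ = μ :=
  Finset.mem_add.1 (MvPolynomial.support_mul s t h)

/-- A monomial of a merged polynomial comes from a member with the same context and type, so it
occurs in the same coefficient. -/
theorem Typing.Sound.of_mem_merge {f : PType → Ser n} {E : Multiset (Typing n)}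
    (hE : ∀ e ∈ E, e.Sound f) {e : Typing n} (he : e ∈ merge E) : e.Sound f := by
  obtain ⟨k, -, rfl⟩ := Finset.mem_image.1 he
  intro μ hμ
  obtain ⟨s, hs, hs'⟩ := exists_mem_support_of_multiset_sum _ (support_minim_subset _ hμ)
  obtain ⟨e', he', rfl⟩ := Multiset.mem_map.1 hs
  obtain ⟨h, rfl⟩ := Multiset.mem_filter.1 he'
  exact hE e' h μ hs'

theorem occurs_prod_of_sound {g : PType → Ser n} (S : Multiset (Typing n))
    (hS : ∀ e ∈ S, e.Sound g) : ∀ μ ∈ (S.map Typing.poly).prod.support,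
      ((S.map Typing.ty).map g).prod.Occurs (S.map Typing.ctx).sum μ := by
  induction S using Multiset.induction_on with
  | empty =>
    intro μ hμ
    obtain rfl : μ = 0 := by
      by_contra h
      simp [MvPolynomial.coeff_one, Ne.symm h] at hμ
    simpa using Ser.occurs_one
  | cons e S ih =>
    intro μ hμ
    simp only [Multiset.map_cons, Multiset.prod_cons, Multiset.sum_cons] at hμ ⊢
    obtain ⟨μ₁, h₁, μ₂, h₂, rfl⟩ := exists_add_of_mem_support_mul hμ
    exact (hS e (Multiset.mem_cons_self e S) μ₁ h₁).mul
      (ih (fun e he => hS e (Multiset.mem_cons_of_mem he)) μ₂ h₂)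

/-- The condition `hB` is what makes the multiset of argument types an index of the sum in `appSer
B`. -/
theorem AppTyping.sound_result {B : Ty} {f g : PType → Ser n} {e : AppTyping n}
    (hf : e.fn.Sound f) (hg : ∀ t ∈ e.args, t.Sound g) (hB : ∀ t ∈ e.args, t.ty ∈ web B) :
    e.result.Sound (appSer B f g) := by
  intro μ hμ
  obtain ⟨μ₁, h₁, μ₂, h₂, rfl⟩ := exists_add_of_mem_support_mul (support_minim_subset _ hμ)
  refine occurs_appSer.2 ⟨e.args.map Typing.ty, ?_,
    Ser.Occurs.mul (hf μ₁ h₁) (occurs_prod_of_sound e.args hg μ₂ h₂)⟩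
  intro b hb
  obtain ⟨t, ht, rfl⟩ := Multiset.mem_map.1 hb
  exact hB t ht

/-- The series `g` stands for the whole choice, of which the scaled branch is one summand; `hg` is
the inclusion of that summand. -/
theorem Typing.sound_scale {f g : PType → Ser n} {p : Param n} {e : Typing n} (he : e.Sound f)
    (hg : ∀ γ μ, Ser.Occurs (MvPowerSeries.C (MvPowerSeries.X p) * f e.ty) γ μ →
      (g e.ty).Occurs γ μ) : (e.scale (MvPolynomial.X p)).Sound g := by
  intro μ hμ
  obtain ⟨μ₁, h₁, μ₂, h₂, rfl⟩ := exists_add_of_mem_support_mul hμ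
  have h₂ : μ₂ = Finsupp.single p 1 :=
    Finset.mem_singleton.1 (MvPolynomial.support_monomial_subset h₂)
  subst h₂
  have H := Ser.Occurs.mul (Ser.occurs_C_X p) (he μ₁ h₁)
  rw [zero_add, add_comm] at H
  exact hg _ _ H

theorem Typing.sound_branch {f g h : PType → Ser n} {e : NatTyping n} {t : Typing n}
    (he : (e.toTyping fun k => k).Sound f) (ht : t.Sound g)
    (hh : ∀ γ μ, (f (PType.base e.val) * g t.ty).Occurs γ μ → (h t.ty).Occurs γ μ) :
    (Typing.branch e t).Sound h := by
  intro μ hμ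
  obtain ⟨μ₁, h₁, μ₂, h₂, rfl⟩ := exists_add_of_mem_support_mul (support_minim_subset _ hμ)
  exact hh _ _ (Ser.Occurs.mul (he μ₁ h₁) (ht μ₂ h₂))

theorem Typing.sound_numeral {f : PType → Ser n} {k : ℕ} (hf : f (PType.base k) = 1) :
    Typing.Sound f ⟨0, 1, PType.base k⟩ := by
  intro μ hμ
  obtain rfl : μ = 0 := by
    by_contra h
    simp [MvPolynomial.coeff_one, Ne.symm h] at hμ
  simpa [hf] using Ser.occurs_one

/-! ### Soundness -/

/-- Used where a semantic clause is cut down to a web: for the premise of a cast and for the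
argument of an application. -/
theorem Refines.adequateJ {Γ : List Ty} {M : Term n} {A : Ty} {J : Finset (Typing n)}
    {d : PDer M J} {D : Deriv Γ M A} (h : Refines d D) : AdequateJ Γ A J := by
  cases h with
  | empty => simp [AdequateJ]
  | zeroNat => simp [AdequateJ, Adequate, web]
  | zeroBool => simp [AdequateJ, Adequate, web]
  | oneBool => simp [AdequateJ, Adequate, web]
  | _ => assumption

theorem Refines.sound {Γ : List Ty} {M : Term n} {A : Ty} {J : Finset (Typing n)}
    {d : PDer M J} {D : Deriv Γ M A} (h : Refines d D) : ∀ e ∈ J, e.Sound (interp D) := by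
  induction h with
  | empty => simp
  | zeroNat | zeroBool | oneBool =>
    intro e he
    rw [Finset.mem_singleton.1 he]
    exact Typing.sound_numeral (by simp [interp])
  | var x h I hJ =>
    intro e he
    have hA := (hJ e he).1
    obtain ⟨a, -, rfl⟩ := Finset.mem_image.1 he
    intro μ hμ
    obtain rfl : μ = 0 := by
      by_contra h
      simp [MvPolynomial.coeff_one, Ne.symm h] at hμ
    simp only [interp, if_pos hA]
    exact Ser.occurs_X_iff.2 ⟨rfl, rfl⟩
  | cast _ hd ih =>
    intro e he μ hμ
    simp only [interp, if_pos (hd.adequateJ e he).1]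
    exact ih e he μ hμ
  | succ _ _ ih =>
    intro e he
    obtain ⟨t, ht, rfl⟩ := Finset.mem_image.1 he
    intro μ hμ
    simp only [interp, NatTyping.toTyping, PType.dest_base]
    exact ih _ (Finset.mem_image_of_mem _ ht) μ hμ
  | pred _ _ ih =>
    intro e he
    refine Typing.Sound.of_mem_merge ?_ he
    intro e he
    obtain ⟨⟨γ, s, k⟩, ht, rfl⟩ := Multiset.mem_map.1 he
    intro μ hμ
    have H := ih _ (Finset.mem_image_of_mem _ ht) μ hμ
    simp only [interp, NatTyping.toTyping, PType.dest_base]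
    -- Both `0` and `1` have predecessor `0`, matching the two summands at `0`; larger values have a
    -- single preimage.
    rcases k with _ | _ | k
    · exact Ser.occurs_add.2 (.inl H)
    · exact Ser.occurs_add.2 (.inr H)
    · exact H
  | ifz _ _ _ _ ihd ihe ihf =>
    intro e he
    refine Typing.Sound.of_mem_merge ?_ he
    intro e he
    rcases Multiset.mem_add.1 he with he | he
    · obtain ⟨⟨t, u⟩, htu, rfl⟩ := Multiset.mem_map.1 he
      obtain ⟨ht, hu⟩ := Finset.mem_product.1 htu
      obtain ⟨ht, h0⟩ := Finset.mem_filter.1 ht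
      refine Typing.sound_branch (ihd _ (Finset.mem_image_of_mem _ ht)) (ihe u hu) ?_
      intro γ μ H
      simp only at h0 H
      rw [h0] at H
      exact Ser.occurs_add.2 (.inl H)
    · obtain ⟨⟨t, u⟩, htu, rfl⟩ := Multiset.mem_map.1 he
      obtain ⟨ht, hu⟩ := Finset.mem_product.1 htu
      obtain ⟨ht, h0⟩ := Finset.mem_filter.1 ht
      refine Typing.sound_branch (ihd _ (Finset.mem_image_of_mem _ ht)) (ihf u hu) ?_
      intro γ μ H
      -- The predecessor of the guard value indexes the summand of the positive branch.
      obtain ⟨k, hk⟩ := Nat.exists_eq_succ_of_ne_zero h0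
      simp only at hk H
      rw [hk] at H
      exact Ser.occurs_add.2 (.inr (Ser.occurs_sum.2 ⟨k, H⟩))
  | choice _ _ _ ihd ihe =>
    intro e he
    refine Typing.Sound.of_mem_merge ?_ he
    intro e he
    rcases Multiset.mem_add.1 he with he | he
    · obtain ⟨t, ht, rfl⟩ := Multiset.mem_map.1 he
      exact Typing.sound_scale (ihd t ht) fun _ _ H => Ser.occurs_add.2 (.inl H)
    · obtain ⟨t, ht, rfl⟩ := Multiset.mem_map.1 he
      exact Typing.sound_scale (ihe t ht) fun _ _ H => Ser.occurs_add.2 (.inr H)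
  | lam _ _ ih =>
    intro e he
    obtain ⟨t, ht, rfl⟩ := Finset.mem_image.1 he
    intro μ hμ
    simp only [interp, LamTyping.abs, PType.dest_arrow]
    -- The coefficient of the abstraction at `γ` is by definition the coefficient of the body at
    -- `Ctx.cons m γ`, the context in `LamTyping.body`.
    exact ih _ (Finset.mem_image_of_mem _ ht) μ hμ
  | app _ _ he ihd ihe =>
    intro t ht
    refine Typing.Sound.of_mem_merge ?_ ht
    intro t ht
    obtain ⟨u, hu, rfl⟩ := Multiset.mem_map.1 ht
    have hmem : ∀ t ∈ u.args, t ∈ Finset.biUnion _ fun e : AppTyping n => e.args.toFinset :=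
      fun t ht => Finset.mem_biUnion.2 ⟨u, hu, Multiset.mem_toFinset.2 ht⟩
    exact AppTyping.sound_result (ihd _ (Finset.mem_image_of_mem _ hu))
      (fun t ht => ihe t (hmem t ht)) fun t ht => (he.adequateJ t (hmem t ht)).1
  | fix hJ _ ih =>
    intro e he μ hμ
    -- The induction hypothesis concerns the unfolding, which is the premise of this refinement
    -- clause; freshness of `y` holds because the typing refines `Γ` without `y`.
    exact occurs_fix_of_occurs_unfold _ _ (hJ e he).fresh (ih e he μ hμ)

/-- The infima are compared monomial by monomial: on the support of `s` the left coefficient is the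
real number `0`, and off it the right coefficient is `∞`. -/
theorem tropEval_tropicalize_le {f : FPS n} {s : TPoly n}
    (h : (s.support : Set (Param n →₀ ℕ)) ⊆ f.supp) (q : Param n → ENNReal) :
    tropEval (tropicalize f) q ≤ tropEval (s : MvPowerSeries (Param n) Trop) q := by
  refine le_iInf fun μ => ?_
  by_cases hμ : μ ∈ s.support
  · refine (iInf_le _ μ).trans (add_le_add ?_ le_rfl)
    have h1 : MvPowerSeries.coeff μ (tropicalize f) = 1 := if_pos (h hμ)
    rw [h1, Tropical.untrop_one]
    exact zero_le
  · rw [MvPolynomial.coeff_coe, MvPolynomial.notMem_support_iff.1 hμ, Tropical.untrop_zero,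
      top_add]
    exact le_top

end

end PCFX

theorem mainTheorem8 (n : ℕ) :
    (∀ (Γ : List PCFX.Ty) (M : PCFX.Term n) (A : PCFX.Ty) (D : PCFX.Deriv Γ M A)
      (γ : PCFX.Ctx) (a : PCFX.PType), PCFX.Adequate Γ A γ a →
      ∀ (s : PCFX.TPoly n) (d : PCFX.PDer M {⟨γ, s, a⟩}), PCFX.Refines d D →
        (s.support : Set (PCFX.Param n →₀ ℕ)) ⊆
          PCFX.FPS.supp (MvPowerSeries.coeff γ (PCFX.interp D a))) ∧
    (∀ (M : PCFX.Term n) (D : PCFX.Deriv [] M PCFX.Ty.nat) (k : ℕ) (s : PCFX.TPoly n)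
      (d : PCFX.PDer M {⟨0, s, PCFX.PType.base k⟩}), PCFX.Refines d D →
      ∀ q : PCFX.Param n → ENNReal,
        PCFX.tropEval
            (PCFX.tropicalize (MvPowerSeries.coeff 0 (PCFX.interp D (PCFX.PType.base k)))) q ≤
          PCFX.tropEval (s : MvPowerSeries (PCFX.Param n) PCFX.Trop) q) := by
  refine ⟨fun Γ M A D γ a _ s d h μ hμ => h.sound _ (Finset.mem_singleton_self _) μ hμ,
    fun M D k s d h => PCFX.tropEval_tropicalize_le fun μ hμ =>
      h.sound _ (Finset.mem_singleton_self _) μ hμ⟩
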